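/- All graphs have a fixed finite vertex set $V$. A DAG is a directed graph without directed cycles; its skeleton is the undirected graph obtained by forgetting directions. A v-structure of a DAG is an induced subgraph $i\to j\leftarrow k$ (with $i\neq k$ non-adjacent). Two DAGs are Markov equivalent if they have the same skeleton and the same v-structures. The essential graph of a DAG $\mathcal D$ is the partially directed graph with the same skeleton as $\mathcal D$ in which an edge is directed $i\to j$ if $i\to j$ in every DAG Markov equivalent to $\mathcal D$, and is undirected if it has neither direction in all of them. The characteristic imset of $\mathcal D$ is the vector $c_{\mathcal D}\in\mathbb R^{\{S\subseteq V:\,|S|\ge 2\}}$ with $c_{\mathcal D}(S)=1$ if there is $i\in S$ such that every element of $S\setminus\{i\}$ is a parent of $i$ in $\mathcal D$, and $c_{\mathcal D}(S)=0$ otherwise. For an undirected graph $G$ on $V$ put $$\mathrm{CIM}_G=\operatorname{conv}\{c_{\mathcal D}:\ \mathcal D\text{ a DAG with skeleton }G\}.$$ An edge of a polytope is a face of dimension one. Let $G$ be a tree and let $\mathcal G,\mathcal H$ be DAGs with skeleton $G$. For $i\in V$ let $N_i=\{S\subseteq V:\ i\in S\subseteq \{i\}\cup \mathrm{ne}_G(i),\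 |S|\ge 3\}$, where $\mathrm{ne}_G(i)$ is the set of neighbours of $i$ in $G$. Let $$\Delta=\{i\in V:\ c_{\mathcal G}|_{N_i}\neq c_{\mathcal H}|_{N_i}\},$$ and let $\operatorname{span}(\Delta)$ be the minimal subtree of $G$ containing $\Delta$. The pair $\{\mathcal G,\mathcal H\}$ is called an essential flip if $\mathcal G$ and $\mathcal H$ are not Markov equivalent, neither of their essential graphs has an undirected edge within $\operatorname{span}(\Delta)$, and the two essential graphs are oppositely directed on every edge of $\operatorname{span}(\Delta)$. **Theorem.** Let $G$ be a tree and let $\mathcal G,\mathcal H$ be DAGs with skeleton $G$. Then $\operatorname{conv}(c_{\mathcal G},c_{\mathcal H})$ is an edge of $\mathrm{CIM}_G$ if and only if $\{\mathcal G,\mathcal H\}$ is an essential flip. -/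

import Mathlib

/-- A directed acyclic graph on the vertex set `V`: no vertex reaches itself by a directed path of
positive length. In particular there are no loops and no pairs of opposite arrows. -/
structure DAG (V : Type*) extends Digraph V where
  acyclic : ∀ v, ¬ Relation.TransGen Adj v v

namespace DAG

variable {V : Type*}

/-- The skeleton: forget the directions of the arrows. -/
def skeleton (D : DAG V) : SimpleGraph V := D.toDigraph.toSimpleGraphInclusive

/-- `i → j ← k` is an induced subgraph of `D`. -/
def IsVStructure (D : DAG V) (i j k : V) : Prop :=
  i ≠ k ∧ D.Adj i j ∧ D.Adj k j ∧ ¬ D.skeleton.Adj i k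

/-- Markov equivalence of DAGs: same skeleton and same v-structures. -/
def MarkovEquiv (D E : DAG V) : Prop :=
  D.skeleton = E.skeleton ∧ ∀ i j k, D.IsVStructure i j k ↔ E.IsVStructure i j k

end DAG

/-- The index set of characteristic imsets: the subsets of `V` with at least two elements. -/
abbrev ImsetIndex (V : Type*) := {S : Finset V // 2 ≤ S.card}

open Classical in
/-- The characteristic imset of `D`: the `0/1` vector whose entry at `S` is `1` exactly if
some `i ∈ S` has all of `S \ {i}` among its parents. -/
noncomputable def DAG.imset {V : Type*} (D : DAG V) : ImsetIndex V → ℝ :=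
  fun S => if ∃ i ∈ S.1, ∀ j ∈ S.1, j ≠ i → D.Adj j i then 1 else 0

/-- The polytope `CIM_G`: the convex hull of the characteristic imsets of all DAGs with
skeleton `G`. -/
def CIM {V : Type*} (G : SimpleGraph V) : Set (ImsetIndex V → ℝ) :=
  convexHull ℝ (DAG.imset '' {D : DAG V | D.skeleton = G})

/-- `F` is an edge of the polytope `P`: a face (the set of maximizers on `P` of a linear
functional) of dimension one. -/
def IsPolytopeEdge {ι : Type*} (P F : Set (ι → ℝ)) : Prop :=
  IsExposed ℝ P F ∧ Module.finrank ℝ (vectorSpan ℝ F) = 1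

/-- A partially directed graph: an undirected graph, some of whose edges carry a direction. -/
structure PartiallyDirectedGraph (V : Type*) where
  skeleton : SimpleGraph V
  /-- `Arrow i j` means that the edge between `i` and `j` is directed, as `i → j`. -/
  Arrow : V → V → Prop
  adj_of_arrow : ∀ {i j}, Arrow i j → skeleton.Adj i j
  asymm : ∀ {i j}, Arrow i j → ¬ Arrow j i

/-- `i - j` is an undirected edge. -/
def PartiallyDirectedGraph.Line {V : Type*} (P : PartiallyDirectedGraph V) (i j : V) : Prop :=
  P.skeleton.Adj i j ∧ ¬ P.Arrow i j ∧ ¬ P.Arrow j i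

/-- The essential graph of (the Markov equivalence class of) `D`: it has the skeleton of `D`, and
the edge between `i` and `j` is directed as `i → j` exactly if `i → j` in every DAG of the class. -/
def DAG.essentialGraph {V : Type*} (D : DAG V) : PartiallyDirectedGraph V where
  skeleton := D.skeleton
  Arrow i j := ∀ D' : DAG V, D.MarkovEquiv D' → D'.Adj i j
  adj_of_arrow {i j} h := by
    have hij : D.Adj i j := h D ⟨rfl, fun _ _ _ => Iff.rfl⟩
    refine ⟨?_, Or.inl hij⟩
    rintro rfl
    exact D.acyclic i (.single hij)
  asymm {i j} h h' := by
    have hD : D.MarkovEquiv D := ⟨rfl, fun _ _ _ => Iff.rfl⟩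
    exact D.acyclic i (.head (h D hD) (.single (h' D hD)))

/-- `N_i`: the sets `S` with `i ∈ S ⊆ ne(i) ∪ {i}` and `|S| ≥ 3`. -/
def localSets {V : Type*} (G : SimpleGraph V) (i : V) : Set (ImsetIndex V) :=
  {S | i ∈ S.1 ∧ (∀ j ∈ S.1, j ∈ insert i (G.neighborSet i)) ∧ 3 ≤ S.1.card}

/-- `Δ`: the vertices `i` such that the characteristic imsets differ on `N_i`. -/
def deltaSet {V : Type*} (G : SimpleGraph V) (D E : DAG V) : Set V :=
  {i | ¬ Set.EqOn D.imset E.imset (localSets G i)}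

/-- The vertex set of the minimal subtree of the tree `G` containing `A`: the intersection of all
vertex sets that contain `A` and induce a connected subgraph. -/
def treeSpan {V : Type*} (G : SimpleGraph V) (A : Set V) : Set V :=
  ⋂₀ {T : Set V | A ⊆ T ∧ (G.induce T).Preconnected}

/-- The essential graphs of the DAGs `D` and `E` with skeleton the tree `G` form an essential flip:
`D` and `E` are not Markov equivalent, and on the span of `Δ` the essential graphs have no
undirected edges and are oppositely directed on every edge. -/
def IsEssentialFlip {V : Type*} (G : SimpleGraph V) (D E : DAG V) : Prop :=
  ¬ D.MarkovEquiv E ∧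
    (∀ i ∈ treeSpan G (deltaSet G D E), ∀ j ∈ treeSpan G (deltaSet G D E),
      ¬ D.essentialGraph.Line i j ∧ ¬ E.essentialGraph.Line i j) ∧
    (∀ i ∈ treeSpan G (deltaSet G D E), ∀ j ∈ treeSpan G (deltaSet G D E),
      (D.essentialGraph.Arrow i j ↔ E.essentialGraph.Arrow j i))

/-! In a forest two parents of a vertex are never adjacent. So a Markov class, and likewise a
characteristic imset with given skeleton, amounts to a choice of the set `colliderParents i` at
every vertex `i`, and `Δ` is where the choices of `D` and `E` differ.

Edges are flips. Suppose members of the two Markov classes agree on an edge of the span of `Δ`. Cut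
both there and exchange the halves: this gives two DAGs whose imsets have the same sum as those of
`D` and `E`. Since `Δ` meets both sides of the cut, an imset off the segment arises, and the segment
is not a face (`not_isExposed_of_agree`). Hence on the span all members of one class are opposite to
all members of the other, which also excludes undirected edges.

Flips are edges. Call `F` between `D` and `E` if at every vertex it looks like one of them.
Indicators of local patterns are affine in the imset, so a functional can punish heavily every
vertex where `F` looks like neither. Add the term `[F is E-like at j] - [F is E-like at i]` for
every pair in `Δ` such that the first condition implies the second for all DAGs in between. The
maximizers are then the DAGs in between at which all these implications are equivalences.

For a flip, each edge of the span is forced by v-structures in both `D` and `E`, and its direction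
in `F` is squeezed between conditions at two vertices of `Δ` (`exists_controls`). The resulting
implications chain along the tree, and at a maximizer agreement with `E` passes from one edge of the
span to the next (`IsTight.agreeAt_iff_agreeAt`). So a maximizer has the imset of `D` or that of
`E`. -/

/-- The vertices on the side of `a` once the edge between `a` and `b` is removed. -/
def SimpleGraph.edgeSide {V : Type*} (G : SimpleGraph V) (a b : V) : Set V :=
  {x | (G.deleteEdges {s(a, b)}).Reachable a x}

/-! ### Sides of an edge in a tree -/

namespace SimpleGraph

variable {V : Type*} {G : SimpleGraph V}

theorem left_mem_edgeSide (a b : V) : a ∈ G.edgeSide a b := Reachable.refl a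

theorem IsAcyclic.right_notMem_edgeSide (hG : G.IsAcyclic) {a b : V} (h : G.Adj a b) :
    b ∉ G.edgeSide a b :=
  isBridge_iff.1 (isAcyclic_iff_forall_adj_isBridge.1 hG h)

theorem edgeSide_of_adj {a b x y : V} (h : G.Adj x y) (hne : s(x, y) ≠ s(a, b))
    (hx : x ∈ G.edgeSide a b) : y ∈ G.edgeSide a b :=
  Reachable.trans hx (Adj.reachable (deleteEdges_adj.2 ⟨h, hne⟩))

theorem mem_edgeSide_iff_of_adj {a b x y : V} (h : G.Adj x y) (hne : s(x, y) ≠ s(a, b)) :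
    x ∈ G.edgeSide a b ↔ y ∈ G.edgeSide a b :=
  ⟨edgeSide_of_adj h hne, edgeSide_of_adj h.symm (by rwa [Sym2.eq_swap])⟩

theorem Connected.mem_edgeSide_or (hG : G.Connected) (a b x : V) :
    x ∈ G.edgeSide a b ∨ x ∈ G.edgeSide b a := by
  obtain ⟨p⟩ := hG.preconnected x a
  induction p with
  | nil => exact Or.inl (left_mem_edgeSide _ _)
  | @cons u v w h p ih =>
    by_cases hne : s(u, v) = s(w, b)
    · rcases Sym2.eq_iff.1 hne with ⟨rfl, -⟩ | ⟨rfl, -⟩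
      · exact Or.inl (left_mem_edgeSide _ _)
      · exact Or.inr (left_mem_edgeSide _ _)
    · refine ih.imp (mem_edgeSide_iff_of_adj h hne).2 (mem_edgeSide_iff_of_adj h ?_).2
      rwa [Sym2.eq_swap (a := b)]

theorem IsAcyclic.not_triangle (hG : G.IsAcyclic) {i j k : V} (hij : G.Adj i j) (hjk : G.Adj j k) :
    ¬ G.Adj i k := fun hik => by
  refine hG.right_notMem_edgeSide hij (edgeSide_of_adj hjk.symm ?_
    (edgeSide_of_adj hik ?_ (left_mem_edgeSide i j)))
  · rw [Ne, Sym2.eq_iff]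
    rintro (⟨rfl, -⟩ | ⟨rfl, -⟩)
    · exact hik.ne rfl
    · exact hjk.ne rfl
  · rw [Ne, Sym2.eq_iff]
    rintro (⟨-, rfl⟩ | ⟨rfl, rfl⟩)
    · exact hjk.ne rfl
    · exact hij.ne rfl

/-- A connected set meeting both sides of an edge contains both endpoints of the edge. -/
theorem mem_of_edgeSide {a b : V} {T : Set V} (hT : (G.induce T).Preconnected) {x y : V}
    (hx : x ∈ T) (hy : y ∈ T) (hxs : x ∈ G.edgeSide a b) (hys : y ∉ G.edgeSide a b) :
    a ∈ T ∧ b ∈ T := by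
  obtain ⟨p⟩ := hT ⟨x, hx⟩ ⟨y, hy⟩
  suffices ∀ u v : T, (G.induce T).Walk u v → u.1 ∈ G.edgeSide a b → v.1 ∉ G.edgeSide a b →
      a ∈ T ∧ b ∈ T from this _ _ p hxs hys
  intro u v p
  induction p with
  | nil => exact fun h h' => (h' h).elim
  | @cons u v w h p ih =>
    intro hu hw
    by_cases hne : s(u.1, v.1) = s(a, b)
    · rcases Sym2.eq_iff.1 hne with ⟨h1, h2⟩ | ⟨h1, h2⟩
      · exact ⟨h1 ▸ u.2, h2 ▸ v.2⟩
      · exact ⟨h2 ▸ v.2, h1 ▸ u.2⟩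
    · exact ih (edgeSide_of_adj h hne hu) hw

theorem edgeSide_preconnected (a b : V) : (G.induce (G.edgeSide a b)).Preconnected := by
  have key : ∀ x (hx : x ∈ G.edgeSide a b),
      (G.induce (G.edgeSide a b)).Reachable ⟨a, left_mem_edgeSide a b⟩ ⟨x, hx⟩ := by
    intro x hx
    obtain ⟨p⟩ := (show (G.deleteEdges {s(a, b)}).Reachable a x from hx).symm
    suffices ∀ u v, (G.deleteEdges {s(a, b)}).Walk u v → ∀ (hu : u ∈ G.edgeSide a b)
        (hv : v ∈ G.edgeSide a b), (G.induce (G.edgeSide a b)).Reachable ⟨v, hv⟩ ⟨u, hu⟩ from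
      this x a p hx (left_mem_edgeSide a b)
    intro u v p
    induction p with
    | nil => exact fun _ _ => Reachable.refl _
    | @cons u v w h p ih =>
      intro hu hw
      have h' := deleteEdges_adj.1 h
      have hv := edgeSide_of_adj h'.1 h'.2 hu
      refine (ih hv hw).trans (Adj.reachable ?_)
      exact h'.1.symm
  exact fun x y => (key x.1 x.2).symm.trans (key y.1 y.2)

end SimpleGraph

/-! ### Spans of vertex sets in a tree -/

section TreeSpan

variable {V : Type*} {G : SimpleGraph V}

theorem subset_treeSpan (A : Set V) : A ⊆ treeSpan G A :=
  fun _ hx => Set.mem_sInter.2 fun _ hT => hT.1 hx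

theorem mem_treeSpan_of_edgeSide {A : Set V} {a b x y : V} (hx : x ∈ A) (hy : y ∈ A)
    (hxs : x ∈ G.edgeSide a b) (hys : y ∉ G.edgeSide a b) :
    a ∈ treeSpan G A :=
  Set.mem_sInter.2 fun _ hT => (SimpleGraph.mem_of_edgeSide hT.2 (hT.1 hx) (hT.1 hy) hxs hys).1

/-- Otherwise `A` lies in the opposite side, which is connected and misses `a`. -/
theorem exists_mem_edgeSide_of_mem_treeSpan (hG : G.IsTree) {A : Set V} {a b : V}
    (hab : G.Adj a b) (ha : a ∈ treeSpan G A) : ∃ x ∈ A, x ∈ G.edgeSide a b := by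
  by_contra! h
  have := Set.mem_sInter.1 ha (G.edgeSide b a)
    ⟨fun x hx => (hG.connected.mem_edgeSide_or a b x).resolve_left (h x hx),
      SimpleGraph.edgeSide_preconnected b a⟩
  exact hG.isAcyclic.right_notMem_edgeSide hab.symm this

/-- Between any two points of `A` there is a walk inside the span of `A`. -/
theorem exists_walk_support_subset_treeSpan (hG : G.IsTree) {A : Set V} {x y : V} (hx : x ∈ A)
    (hy : y ∈ A) : ∃ p : G.Walk x y, ∀ z ∈ p.support, z ∈ treeSpan G A := by
  classical
  obtain ⟨p⟩ := hG.connected.preconnected x y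
  refine ⟨p.toPath.1, fun z hz => Set.mem_sInter.2 fun T hT => ?_⟩
  obtain ⟨q⟩ := hT.2 ⟨x, hT.1 hx⟩ ⟨y, hT.1 hy⟩
  let q' : G.Walk x y := q.map (SimpleGraph.Embedding.induce T).toHom
  -- Paths in a tree are unique, so the path from `x` to `y` runs inside every connected set
  -- containing both.
  have hsub := (hG.isAcyclic.subsingleton_path x y).elim p.toPath q'.toPath
  rw [hsub] at hz
  have hz' := q'.support_toPath_subset_support hz
  rw [show q'.support = _ from SimpleGraph.Walk.support_map _ _, List.mem_map] at hz'
  obtain ⟨w, -, rfl⟩ := hz'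
  exact w.2

end TreeSpan

/-! ### Orientations of forests -/

namespace DAG

variable {V : Type*} {G : SimpleGraph V} {D E : DAG V}

theorem deltaSet_comm : deltaSet G D E = deltaSet G E D :=
  Set.ext fun _ => not_congr Set.eqOn_comm

theorem skeleton_adj {i j : V} : D.skeleton.Adj i j ↔ D.Adj i j ∨ D.Adj j i := by
  refine ⟨fun h => h.2, fun h => ⟨?_, h⟩⟩
  rintro rfl
  exact D.acyclic i (.single (h.elim id id))

theorem not_adj_symm {i j : V} (h : D.Adj i j) : ¬ D.Adj j i :=
  fun h' => D.acyclic i (.head h (.single h'))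

theorem adj_or (hD : D.skeleton = G) {i j : V} (h : G.Adj i j) : D.Adj i j ∨ D.Adj j i :=
  skeleton_adj.1 (hD ▸ h)

theorem graph_adj (hD : D.skeleton = G) {i j : V} (h : D.Adj i j) : G.Adj i j :=
  hD ▸ skeleton_adj.2 (Or.inl h)

/-- An orientation of the edges of a forest has no directed cycles. -/
theorem not_transGen_of_orientation (hG : G.IsAcyclic) {r : V → V → Prop}
    (hr : ∀ i j, r i j → G.Adj i j) (hasymm : ∀ i j, r i j → ¬ r j i) (v : V) :
    ¬ Relation.TransGen r v v := by
  intro h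
  obtain ⟨w, hvw, hwv⟩ := Relation.TransGen.head'_iff.1 h
  -- After the arrow `v → w`, the only way back to `v` is over the same edge, against its direction.
  have key : ∀ x, Relation.ReflTransGen r w x → x ∈ G.edgeSide w v := by
    intro x hx
    induction hx with
    | refl => exact SimpleGraph.left_mem_edgeSide _ _
    | @tail x y _ hxy ih =>
      by_cases hne : s(x, y) = s(w, v)
      · rcases Sym2.eq_iff.1 hne with ⟨rfl, rfl⟩ | ⟨rfl, rfl⟩
        · exact (hasymm _ _ hvw hxy).elim
        · exact SimpleGraph.left_mem_edgeSide _ _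
      · exact SimpleGraph.edgeSide_of_adj (hr _ _ hxy) hne ih
  exact hG.right_notMem_edgeSide (hr _ _ hvw).symm (key v hwv)

/-- The DAG given by an orientation of the edges of a forest. -/
def ofOrientation (hG : G.IsAcyclic) (r : V → V → Prop)
    (hr : ∀ i j, r i j → G.Adj i j) (hasymm : ∀ i j, r i j → ¬ r j i) : DAG V where
  Adj := r
  acyclic := not_transGen_of_orientation hG hr hasymm

theorem ofOrientation_skeleton (hG : G.IsAcyclic) (r : V → V → Prop)
    (hr : ∀ i j, r i j → G.Adj i j) (hasymm : ∀ i j, r i j → ¬ r j i)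
    (htotal : ∀ i j, G.Adj i j → r i j ∨ r j i) :
    (ofOrientation hG r hr hasymm).skeleton = G := by
  ext i j
  rw [skeleton_adj]
  exact ⟨fun h => h.elim (hr _ _) fun h => (hr _ _ h).symm, htotal i j⟩

/-- The source of a directed path is on the tail side of the last edge. -/
theorem mem_edgeSide_of_reflTransGen (hD : D.skeleton = G) {i a b : V}
    (h : Relation.ReflTransGen D.Adj i a) (hab : D.Adj a b) : i ∈ G.edgeSide a b := by
  induction h using Relation.ReflTransGen.head_induction_on with
  | refl => exact SimpleGraph.left_mem_edgeSide _ _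
  | @head x y hxy hya ih =>
    refine (SimpleGraph.mem_edgeSide_iff_of_adj (graph_adj hD hxy) ?_).2 ih
    rw [Ne, Sym2.eq_iff]
    rintro (⟨rfl, rfl⟩ | ⟨rfl, rfl⟩)
    · exact D.acyclic _ (Relation.TransGen.head' hxy hya)
    · exact not_adj_symm hxy hab

end DAG

/-! ### Collider parents encode Markov classes and imsets -/

namespace DAG

variable {V : Type*} [Fintype V] {G : SimpleGraph V} {D E F : DAG V}

open Classical in
/-- The parents of `i` if there are at least two of them, and no vertex otherwise. -/
noncomputable def colliderParents (D : DAG V) (i : V) : Finset V :=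
  {j | D.Adj j i ∧ ∃ k, k ≠ j ∧ D.Adj k i}

theorem mem_colliderParents {i j : V} :
    j ∈ D.colliderParents i ↔ D.Adj j i ∧ ∃ k, k ≠ j ∧ D.Adj k i := by
  simp [colliderParents]

theorem adj_of_mem_colliderParents {i j : V} (h : j ∈ D.colliderParents i) : D.Adj j i :=
  (mem_colliderParents.1 h).1

theorem mem_colliderParents_of_adj {i j k : V} (hj : D.Adj j i) (hk : D.Adj k i) (hjk : j ≠ k) :
    j ∈ D.colliderParents i :=
  mem_colliderParents.2 ⟨hj, k, hjk.symm, hk⟩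

theorem mem_colliderParents_of_nonempty {i j : V} (h : (D.colliderParents i).Nonempty)
    (hj : D.Adj j i) : j ∈ D.colliderParents i := by
  obtain ⟨k, hk⟩ := h
  by_cases hjk : j = k
  · exact hjk ▸ hk
  · exact mem_colliderParents_of_adj hj (adj_of_mem_colliderParents hk) hjk

theorem exists_ne_mem_colliderParents {i j : V} (h : j ∈ D.colliderParents i) :
    ∃ k ∈ D.colliderParents i, k ≠ j := by
  obtain ⟨hj, k, hkj, hk⟩ := mem_colliderParents.1 h
  exact ⟨k, mem_colliderParents_of_adj hk hj hkj, hkj⟩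

theorem isVStructure_iff (hG : G.IsAcyclic) (hD : D.skeleton = G) {i j k : V} :
    D.IsVStructure i j k ↔ i ≠ k ∧ i ∈ D.colliderParents j ∧ k ∈ D.colliderParents j := by
  constructor
  · rintro ⟨hik, hi, hk, -⟩
    exact ⟨hik, mem_colliderParents_of_adj hi hk hik, mem_colliderParents_of_adj hk hi hik.symm⟩
  · rintro ⟨hik, hi, hk⟩
    have hi := adj_of_mem_colliderParents hi
    have hk := adj_of_mem_colliderParents hk
    exact ⟨hik, hi, hk, hD ▸ hG.not_triangle (graph_adj hD hi) (graph_adj hD hk).symm⟩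

theorem markovEquiv_iff (hG : G.IsAcyclic) (hD : D.skeleton = G) (hE : E.skeleton = G) :
    D.MarkovEquiv E ↔ D.colliderParents = E.colliderParents := by
  constructor
  · rintro ⟨-, h⟩
    funext i
    suffices ∀ {D E : DAG V}, D.skeleton = G → E.skeleton = G →
        (∀ i j k, D.IsVStructure i j k ↔ E.IsVStructure i j k) →
        D.colliderParents i ⊆ E.colliderParents i from
      (this hD hE h).antisymm (this hE hD fun i j k => (h i j k).symm)
    intro D E hD hE h j hj
    obtain ⟨k, hk, hkj⟩ := exists_ne_mem_colliderParents hj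
    have := (isVStructure_iff hG hD).2 ⟨hkj, hk, hj⟩
    exact ((isVStructure_iff hG hE).1 ((h _ _ _).1 this)).2.2
  · intro h
    refine ⟨hD.trans hE.symm, fun i j k => ?_⟩
    rw [isVStructure_iff hG hD, isVStructure_iff hG hE, h]

theorem imset_eq_one_iff {S : ImsetIndex V} :
    D.imset S = 1 ↔ ∃ i ∈ S.1, ∀ j ∈ S.1, j ≠ i → D.Adj j i := by
  unfold imset
  split_ifs with h <;> simp [h]

theorem imset_eq_zero_or_one (S : ImsetIndex V) : D.imset S = 0 ∨ D.imset S = 1 := by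
  unfold imset
  split_ifs <;> simp

theorem imset_eq_iff {S : ImsetIndex V} :
    D.imset S = E.imset S ↔ (D.imset S = 1 ↔ E.imset S = 1) := by
  rcases D.imset_eq_zero_or_one S with h | h <;> rcases E.imset_eq_zero_or_one S with h' | h' <;>
    simp [h, h']

/-- With at least three elements in the star of `i`, only `i` can be the common child: any other
one, together with `i` and a third element, would form a triangle. -/
theorem imset_eq_one_iff_of_mem_localSets (hG : G.IsAcyclic) (hD : D.skeleton = G) {i : V}
    {S : ImsetIndex V} (hS : S ∈ localSets G i) :
    D.imset S = 1 ↔ ∀ j ∈ S.1, j ≠ i → j ∈ D.colliderParents i := by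
  classical
  obtain ⟨hiS, hne, hcard⟩ := hS
  have hthird : ∀ j, ∃ k ∈ S.1, k ≠ i ∧ k ≠ j := by
    intro j
    have h1 : ({i, j} : Finset V).card < S.1.card := lt_of_le_of_lt Finset.card_le_two hcard
    obtain ⟨k, hk, hk'⟩ := Finset.exists_mem_notMem_of_card_lt_card h1
    simp only [Finset.mem_insert, Finset.mem_singleton, not_or] at hk'
    exact ⟨k, hk, hk'⟩
  rw [imset_eq_one_iff]
  constructor
  · rintro ⟨i', hi', h⟩
    have hii' : i' = i := by
      by_contra hii'
      obtain ⟨k, hk, hki, hki'⟩ := hthird i'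
      have hik : G.Adj i k := (hne k hk).resolve_left hki
      exact hG.not_triangle hik (graph_adj hD (h k hk hki'))
        (graph_adj hD (h i hiS (Ne.symm hii')))
    subst hii'
    intro j hj hji
    obtain ⟨k, hk, hki, hkj⟩ := hthird j
    exact mem_colliderParents_of_adj (h j hj hji) (h k hk hki) hkj.symm
  · exact fun h => ⟨i, hiS, fun j hj hji => adj_of_mem_colliderParents (h j hj hji)⟩

theorem exists_mem_localSets_of_mem_colliderParents (hD : D.skeleton = G) {i j : V}
    (hj : j ∈ D.colliderParents i) : ∃ S ∈ localSets G i, j ∈ S.1 ∧ j ≠ i ∧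
      ∀ k ∈ S.1, k ≠ i → k ∈ D.colliderParents i := by
  classical
  obtain ⟨k, hk, hkj⟩ := exists_ne_mem_colliderParents hj
  have hji := graph_adj hD (adj_of_mem_colliderParents hj)
  have hki := graph_adj hD (adj_of_mem_colliderParents hk)
  have hcard : ({i, j, k} : Finset V).card = 3 :=
    Finset.card_eq_three.2 ⟨i, j, k, hji.ne', hki.ne', hkj.symm, rfl⟩
  refine ⟨⟨{i, j, k}, by omega⟩, ⟨by simp, ?_, hcard.ge⟩, by simp, hji.ne, ?_⟩
  · intro x hx
    simp only [Finset.mem_insert, Finset.mem_singleton] at hx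
    rcases hx with rfl | rfl | rfl
    · exact Or.inl rfl
    · exact Or.inr hji.symm
    · exact Or.inr hki.symm
  · intro x hx hxi
    simp only [Finset.mem_insert, Finset.mem_singleton] at hx
    rcases hx with rfl | rfl | rfl
    · exact (hxi rfl).elim
    · exact hj
    · exact hk

theorem eqOn_localSets_iff (hG : G.IsAcyclic) (hD : D.skeleton = G) (hE : E.skeleton = G) {i : V} :
    Set.EqOn D.imset E.imset (localSets G i) ↔ D.colliderParents i = E.colliderParents i := by
  constructor
  · intro h
    suffices ∀ {D E : DAG V}, D.skeleton = G → E.skeleton = G →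
        Set.EqOn D.imset E.imset (localSets G i) →
        D.colliderParents i ⊆ E.colliderParents i from
      (this hD hE h).antisymm (this hE hD h.symm)
    intro D E hD hE h j hj
    obtain ⟨S, hS, hjS, hji, hk⟩ := exists_mem_localSets_of_mem_colliderParents hD hj
    have h1 := (imset_eq_one_iff_of_mem_localSets hG hD hS).2 hk
    rw [h hS] at h1
    exact (imset_eq_one_iff_of_mem_localSets hG hE hS).1 h1 j hjS hji
  · intro h S hS
    rw [imset_eq_iff, imset_eq_one_iff_of_mem_localSets hG hD hS,
      imset_eq_one_iff_of_mem_localSets hG hE hS, h]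

/-- Outside the local sets, characteristic imsets depend on the skeleton only. -/
theorem imset_eq_of_notMem_localSets (hD : D.skeleton = G) (hE : E.skeleton = G)
    {S : ImsetIndex V} (hS : ∀ i, S ∉ localSets G i) : D.imset S = E.imset S := by
  suffices ∀ {D E : DAG V}, D.skeleton = G → E.skeleton = G → D.imset S = 1 → E.imset S = 1 from
    imset_eq_iff.2 ⟨this hD hE, this hE hD⟩
  intro D E hD hE h
  obtain ⟨i, hi, h⟩ := imset_eq_one_iff.1 h
  have hcard : S.1.card = 2 := by
    refine le_antisymm (not_lt.1 fun hlt => hS i ⟨hi, fun j hj => ?_, hlt⟩) S.2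
    by_cases hji : j = i
    · exact Or.inl hji
    · exact Or.inr (graph_adj hD (h j hj hji)).symm
  obtain ⟨x, hx, hxi⟩ := Finset.exists_mem_ne S.2 i
  have hmem : ∀ y ∈ S.1, y = i ∨ y = x := by
    classical
    have : ({i, x} : Finset V) = S.1 := by
      refine Finset.eq_of_subset_of_card_le ?_ ?_
      · intro y hy
        simp only [Finset.mem_insert, Finset.mem_singleton] at hy
        rcases hy with rfl | rfl <;> assumption
      · rw [hcard, Finset.card_pair hxi.symm]
    intro y hy
    rw [← this] at hy
    simpa using hy
  rcases adj_or hE (graph_adj hD (h x hx hxi)) with hE' | hE'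
  · refine imset_eq_one_iff.2 ⟨i, hi, fun j hj hji => ?_⟩
    rwa [(hmem j hj).resolve_left hji]
  · refine imset_eq_one_iff.2 ⟨x, hx, fun j hj hjx => ?_⟩
    rwa [(hmem j hj).resolve_right hjx]

theorem imset_eq_iff_colliderParents (hG : G.IsAcyclic) (hD : D.skeleton = G)
    (hE : E.skeleton = G) : D.imset = E.imset ↔ D.colliderParents = E.colliderParents := by
  constructor
  · exact fun h => funext fun i => (eqOn_localSets_iff hG hD hE).1 fun S _ => congrFun h S
  · intro h
    funext S
    by_cases hS : ∃ i, S ∈ localSets G i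
    · obtain ⟨i, hi⟩ := hS
      exact (eqOn_localSets_iff hG hD hE).2 (congrFun h i) hi
    · exact imset_eq_of_notMem_localSets hD hE (not_exists.1 hS)

theorem mem_deltaSet_iff (hG : G.IsAcyclic) (hD : D.skeleton = G) (hE : E.skeleton = G) {i : V} :
    i ∈ deltaSet G D E ↔ D.colliderParents i ≠ E.colliderParents i :=
  not_congr (eqOn_localSets_iff hG hD hE)

end DAG

/-! ### Segments as exposed faces -/

/-- An exposed face of the convex hull of a finite set is described by the points at which a linear
functional attains its maximum. -/
theorem isExposed_convexHull_pair {ι : Type*} {S : Set (ι → ℝ)} (hS : S.Finite) {u v : ι → ℝ}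
    (hu : u ∈ S) (hv : v ∈ S) (l : StrongDual ℝ (ι → ℝ)) (M : ℝ) (hlu : l u = M) (hlv : l v = M)
    (hle : ∀ w ∈ S, l w ≤ M) (heq : ∀ w ∈ S, l w = M → w = u ∨ w = v) :
    IsExposed ℝ (convexHull ℝ S) (convexHull ℝ {u, v}) := by
  intro _
  refine ⟨l, ?_⟩
  have hle' : ∀ w ∈ convexHull ℝ S, l w ≤ M :=
    fun w hw => convexHull_min (t := {w | l w ≤ M}) hle (convex_halfSpace_le l.isLinear M) hw
  have huS : u ∈ convexHull ℝ S := subset_convexHull ℝ S hu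
  set B : Set (ι → ℝ) := {x | x ∈ convexHull ℝ S ∧ ∀ y ∈ convexHull ℝ S, l y ≤ l x} with hB
  have hBM : ∀ x, x ∈ B ↔ x ∈ convexHull ℝ S ∧ l x = M := by
    refine fun x => ⟨fun h => ⟨h.1, (hle' x h.1).antisymm ?_⟩, fun h => ⟨h.1, fun y hy => ?_⟩⟩
    · exact hlu ▸ h.2 u huS
    · exact h.2.symm ▸ hle' y hy
  have hexp : IsExposed ℝ (convexHull ℝ S) B := fun _ => ⟨l, rfl⟩
  have hBconv : Convex ℝ B := hexp.convex (convex_convexHull ℝ S)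
  have hBcomp : IsCompact B := hexp.isCompact (hS.isCompact_convexHull ℝ)
  apply Set.Subset.antisymm
  · refine convexHull_min ?_ hBconv
    rintro x (rfl | rfl)
    · exact (hBM _).2 ⟨huS, hlu⟩
    · exact (hBM _).2 ⟨subset_convexHull ℝ S hv, hlv⟩
  -- Krein–Milman: the face is generated by its extreme points, which are extreme in the whole hull
  -- and hence belong to `S`.
  · rw [← closure_convexHull_extremePoints hBcomp hBconv]
    refine closure_minimal (convexHull_mono fun x hx => ?_)
      ((Set.toFinite {u, v}).isCompact_convexHull ℝ).isClosed
    have hxS : x ∈ S :=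
      extremePoints_convexHull_subset (hexp.isExtreme.extremePoints_subset_extremePoints hx)
    exact heq x hxS ((hBM x).1 hx.1).2

theorem finrank_vectorSpan_convexHull_pair {E : Type*} [AddCommGroup E] [Module ℝ E] {u v : E} :
    Module.finrank ℝ (vectorSpan ℝ (convexHull ℝ {u, v})) = 1 ↔ u ≠ v := by
  rw [← direction_affineSpan, affineSpan_convexHull, direction_affineSpan, vectorSpan_pair]
  constructor
  · rintro h rfl
    rw [vsub_self, Submodule.span_zero_singleton, finrank_bot] at h
    exact zero_ne_one h
  · exact fun h => finrank_span_singleton (sub_ne_zero.2 h)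

/-! ### Edges of the polytope are essential flips -/

namespace DAG

variable {V : Type*} [Fintype V] {G : SimpleGraph V} {D E F : DAG V}

theorem finite_imset_image (s : Set (DAG V)) : (imset '' s).Finite := by
  refine Set.Finite.subset (Set.Finite.pi' fun _ : ImsetIndex V => Set.toFinite ({0, 1} : Set ℝ)) ?_
  rintro _ ⟨D, -, rfl⟩ S
  exact D.imset_eq_zero_or_one S

/-- Two orientations of a tree that agree at an edge can be glued along this edge. -/
theorem exists_glue (hG : G.IsAcyclic) (hD : D.skeleton = G) (hE : E.skeleton = G) {a b : V}
    (hDab : D.Adj a b) (hEab : E.Adj a b) : ∃ W : DAG V, W.skeleton = G ∧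
      (∀ i ∈ G.edgeSide a b, W.colliderParents i = D.colliderParents i) ∧
      (∀ i ∉ G.edgeSide a b, W.colliderParents i = E.colliderParents i) := by
  let r : V → V → Prop := fun x y =>
    (y ∈ G.edgeSide a b ∧ D.Adj x y) ∨ (y ∉ G.edgeSide a b ∧ E.Adj x y)
  have hr : ∀ x y, r x y → G.Adj x y := by
    rintro x y (⟨-, h⟩ | ⟨-, h⟩)
    · exact graph_adj hD h
    · exact graph_adj hE h
  -- `r` tests the side of the head, so that parents are inherited vertex by vertex. Testing the
  -- tail gives the same: only the edge between `a` and `b` changes sides, and there `D` and `E`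
  -- agree. Hence `r` is an orientation.
  have hr' : ∀ x y, G.Adj x y →
      (r x y ↔ (x ∈ G.edgeSide a b ∧ D.Adj x y) ∨ (x ∉ G.edgeSide a b ∧ E.Adj x y)) := by
    intro x y hxy
    by_cases hne : s(x, y) = s(a, b)
    · have hDE : D.Adj x y ↔ E.Adj x y := by
        rcases Sym2.eq_iff.1 hne with ⟨rfl, rfl⟩ | ⟨rfl, rfl⟩
        · exact iff_of_true hDab hEab
        · exact iff_of_false (not_adj_symm hDab) (not_adj_symm hEab)
      simp only [r, hDE]
      tauto
    · simp only [r, SimpleGraph.mem_edgeSide_iff_of_adj hxy hne]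
  have hasymm : ∀ x y, r x y → ¬ r y x := by
    intro x y hxy hyx
    rw [hr' x y (hr x y hxy)] at hxy
    rcases hxy with ⟨hx, h⟩ | ⟨hx, h⟩ <;> rcases hyx with ⟨hx', h'⟩ | ⟨hx', h'⟩
    · exact not_adj_symm h h'
    · exact hx' hx
    · exact hx hx'
    · exact not_adj_symm h h'
  have htotal : ∀ x y, G.Adj x y → r x y ∨ r y x := by
    intro x y hxy
    rw [hr' x y hxy]
    by_cases hx : x ∈ G.edgeSide a b
    · exact (adj_or hD hxy).imp (fun h => Or.inl ⟨hx, h⟩) fun h => Or.inl ⟨hx, h⟩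
    · exact (adj_or hE hxy).imp (fun h => Or.inr ⟨hx, h⟩) fun h => Or.inr ⟨hx, h⟩
  refine ⟨ofOrientation hG r hr hasymm, ofOrientation_skeleton hG r hr hasymm htotal, ?_, ?_⟩
  · intro i hi
    ext j
    simp [mem_colliderParents, ofOrientation, r, hi]
  · intro i hi
    ext j
    simp [mem_colliderParents, ofOrientation, r, hi]

/-- Gluing `D'` and `E'` in both ways gives `W` and `Z` whose imsets have the same midpoint as those
of `D` and `E`. If the segment were a face it would contain the imset of `W`. But that one looks
like `D` at a vertex of `Δ` on one side and like `E` at one on the other, which no point of the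
segment does. -/
theorem not_isExposed_of_agree (hG : G.IsTree) (hD : D.skeleton = G) (hE : E.skeleton = G)
    {D' E' : DAG V} (hD' : D.MarkovEquiv D') (hE' : E.MarkovEquiv E') {a b : V}
    (ha : a ∈ treeSpan G (deltaSet G D E)) (hb : b ∈ treeSpan G (deltaSet G D E))
    (hDab : D'.Adj a b) (hEab : E'.Adj a b) :
    ¬ IsExposed ℝ (CIM G) (convexHull ℝ {D.imset, E.imset}) := by
  intro hexp
  have hac := hG.isAcyclic
  have hDs : D'.skeleton = G := hD'.1.symm.trans hD
  have hEs : E'.skeleton = G := hE'.1.symm.trans hE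
  have hDc := (markovEquiv_iff hac hD hDs).1 hD'
  have hEc := (markovEquiv_iff hac hE hEs).1 hE'
  obtain ⟨W, hW, hWa, hWb⟩ := exists_glue hac hDs hEs hDab hEab
  obtain ⟨Z, hZ, hZa, hZb⟩ := exists_glue hac hEs hDs hEab hDab
  have hab := graph_adj hDs hDab
  obtain ⟨x, hx, hxs⟩ := exists_mem_edgeSide_of_mem_treeSpan hG hab ha
  obtain ⟨y, hy, hys⟩ := exists_mem_edgeSide_of_mem_treeSpan hG hab.symm hb
  have hys' : y ∉ G.edgeSide a b := fun h =>
    hac.right_notMem_edgeSide hab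
      ((show (G.deleteEdges {s(a, b)}).Reachable a y from h).trans
        (show (G.deleteEdges {s(a, b)}).Reachable y b by rw [Sym2.eq_swap]; exact hys.symm))
  have hsum : ∀ S, W.imset S + Z.imset S = D.imset S + E.imset S := by
    intro S
    by_cases hS : ∃ i, S ∈ localSets G i
    · obtain ⟨i, hi⟩ := hS
      by_cases his : i ∈ G.edgeSide a b
      · rw [(eqOn_localSets_iff hac hW hD).2 ((hWa i his).trans (congrFun hDc i).symm) hi,
          (eqOn_localSets_iff hac hZ hE).2 ((hZa i his).trans (congrFun hEc i).symm) hi]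
      · rw [(eqOn_localSets_iff hac hW hE).2 ((hWb i his).trans (congrFun hEc i).symm) hi,
          (eqOn_localSets_iff hac hZ hD).2 ((hZb i his).trans (congrFun hDc i).symm) hi, add_comm]
    · have hS := not_exists.1 hS
      rw [imset_eq_of_notMem_localSets hW hD hS, imset_eq_of_notMem_localSets hZ hE hS]
  have hWP : W.imset ∈ CIM G := subset_convexHull ℝ _ ⟨W, hW, rfl⟩
  have hZP : Z.imset ∈ CIM G := subset_convexHull ℝ _ ⟨Z, hZ, rfl⟩
  have hmid : (1 / 2 : ℝ) • D.imset + (1 / 2 : ℝ) • E.imset ∈ convexHull ℝ {D.imset, E.imset} := by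
    rw [convexHull_pair]
    exact ⟨1 / 2, 1 / 2, by norm_num, by norm_num, by norm_num, rfl⟩
  have hmid' : (1 / 2 : ℝ) • D.imset + (1 / 2 : ℝ) • E.imset ∈
      openSegment ℝ W.imset Z.imset := by
    refine ⟨1 / 2, 1 / 2, by norm_num, by norm_num, by norm_num, ?_⟩
    rw [← smul_add, ← smul_add]
    exact congrArg _ (funext hsum)
  have hWF := hexp.isExtreme.left_mem_of_mem_openSegment hWP hZP hmid hmid'
  rw [convexHull_pair] at hWF
  obtain ⟨s, t, hs, ht, hst, hWst⟩ := hWF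
  have hWS : ∀ S, s * D.imset S + t * E.imset S = W.imset S := fun S => congrFun hWst S
  obtain ⟨S₁, hS₁, hne₁⟩ : ∃ S ∈ localSets G x, D.imset S ≠ E.imset S := by
    by_contra! h
    exact hx h
  obtain ⟨S₂, hS₂, hne₂⟩ : ∃ S ∈ localSets G y, D.imset S ≠ E.imset S := by
    by_contra! h
    exact hy h
  have h1 := hWS S₁
  rw [(eqOn_localSets_iff hac hW hD).2 ((hWa x hxs).trans (congrFun hDc x).symm) hS₁] at h1
  have h2 := hWS S₂
  rw [(eqOn_localSets_iff hac hW hE).2 ((hWb y hys').trans (congrFun hEc y).symm) hS₂] at h2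
  have hs1 : s = 1 - t := by linarith
  subst hs1
  have ht0 : t = 0 := by
    have : t * (E.imset S₁ - D.imset S₁) = 0 := by linarith
    exact (mul_eq_zero.1 this).resolve_right (sub_ne_zero.2 hne₁.symm)
  subst ht0
  exact hne₂ (by linarith)

/-- Each failure of the conditions on the span yields members of the two classes agreeing on an
edge: an undirected edge takes both directions within its class, so one of them matches the other
DAG. -/
theorem isEssentialFlip_of_isPolytopeEdge (hG : G.IsTree) (hD : D.skeleton = G)
    (hE : E.skeleton = G) (h : IsPolytopeEdge (CIM G) (convexHull ℝ {D.imset, E.imset})) :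
    IsEssentialFlip G D E := by
  obtain ⟨hexp, hdim⟩ := h
  have hagree : ∀ {D' E' : DAG V} {a b : V}, D.MarkovEquiv D' → E.MarkovEquiv E' →
      a ∈ treeSpan G (deltaSet G D E) → b ∈ treeSpan G (deltaSet G D E) →
      D'.Adj a b → ¬ E'.Adj a b := fun hD' hE' ha hb hDab hEab =>
    not_isExposed_of_agree hG hD hE hD' hE' ha hb hDab hEab hexp
  have hrefl : ∀ F : DAG V, F.MarkovEquiv F := fun _ => ⟨rfl, fun _ _ _ => Iff.rfl⟩
  have hrev : ∀ {F F' : DAG V} {a b : V}, F.skeleton = G → F.MarkovEquiv F' → G.Adj a b →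
      ¬ F'.Adj a b → F'.Adj b a := fun hF hF' hab hn =>
    (adj_or (hF'.1.symm.trans hF) hab).resolve_left hn
  have hline : ∀ a ∈ treeSpan G (deltaSet G D E), ∀ b ∈ treeSpan G (deltaSet G D E),
      ¬ D.essentialGraph.Line a b ∧ ¬ E.essentialGraph.Line a b := by
    intro a ha b hb
    constructor
    · rintro ⟨hab, h1, h2⟩
      obtain ⟨D₁, hD₁, hn₁⟩ : ∃ D', D.MarkovEquiv D' ∧ ¬ D'.Adj a b := by
        by_contra! h; exact h1 h
      obtain ⟨D₂, hD₂, hn₂⟩ : ∃ D', D.MarkovEquiv D' ∧ ¬ D'.Adj b a := by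
        by_contra! h; exact h2 h
      have hab : G.Adj a b := hD ▸ hab
      rcases adj_or hE hab with h | h
      · exact hagree hD₂ (hrefl E) ha hb (hrev hD hD₂ hab.symm hn₂) h
      · exact hagree hD₁ (hrefl E) hb ha (hrev hD hD₁ hab hn₁) h
    · rintro ⟨hab, h1, h2⟩
      obtain ⟨E₁, hE₁, hn₁⟩ : ∃ E', E.MarkovEquiv E' ∧ ¬ E'.Adj a b := by
        by_contra! h; exact h1 h
      obtain ⟨E₂, hE₂, hn₂⟩ : ∃ E', E.MarkovEquiv E' ∧ ¬ E'.Adj b a := by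
        by_contra! h; exact h2 h
      have hab : G.Adj a b := hE ▸ hab
      rcases adj_or hD hab with h | h
      · exact hagree (hrefl D) hE₂ ha hb h (hrev hE hE₂ hab.symm hn₂)
      · exact hagree (hrefl D) hE₁ hb ha h (hrev hE hE₁ hab hn₁)
  refine ⟨fun hDE => ?_, hline, fun a ha b hb => ⟨fun h => ?_, fun h => ?_⟩⟩
  · exact finrank_vectorSpan_convexHull_pair.1 hdim
      ((imset_eq_iff_colliderParents hG.isAcyclic hD hE).2
        ((markovEquiv_iff hG.isAcyclic hD hE).1 hDE))
  · intro E' hE'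
    have hab := graph_adj hD (h D (hrefl D))
    exact hrev hE hE' hab (hagree (hrefl D) hE' ha hb (h D (hrefl D)))
  · intro D' hD'
    have hab := graph_adj hE (h E (hrefl E))
    exact hrev hD hD' hab fun hba => hagree hD' (hrefl E) hb ha hba (h E (hrefl E))

end DAG

/-! ### Forced arrows and the vertices controlling them -/

namespace DAG

variable {V : Type*} [Fintype V] {G : SimpleGraph V} {D E F : DAG V}

/-- The arrows whose direction is determined by the v-structures: those entering a collider, and
those continuing such arrows. -/
inductive Forced (D : DAG V) : V → V → Prop
  | collider {a b : V} : a ∈ D.colliderParents b → Forced D a b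
  | step {p a b : V} : Forced D p a → D.Adj a b → Forced D a b

/-- A forced arrow into an ancestor of `b` propagates down to a forced arrow into `b`. Its tail is
either `a` or a second parent of `b`, and in both cases `a → b` is forced. -/
theorem not_forced_of_reflTransGen {a b : V} (hab : D.Adj a b) (h : ¬ D.Forced a b) {y : V}
    (hy : Relation.ReflTransGen D.Adj y b) (p : V) : ¬ D.Forced p y := by
  induction hy using Relation.ReflTransGen.head_induction_on generalizing p with
  | refl =>
    intro hp
    cases hp with
    | collider hp =>
      exact h (.collider (mem_colliderParents_of_nonempty ⟨p, hp⟩ hab))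
    | step hq hpb =>
      by_cases hpa : p = a
      · exact h (hpa ▸ .step hq hpb)
      · exact h (.collider (mem_colliderParents_of_adj hab hpb (Ne.symm hpa)))
  | head hyz _ ih => exact fun hp => ih _ (.step hp hyz)

/-- An arrow that is not forced is reversed in some Markov equivalent DAG: reverse all arrows
leading to its head. -/
theorem exists_markovEquiv_adj_of_not_forced (hG : G.IsAcyclic) (hD : D.skeleton = G) {a b : V}
    (hab : D.Adj a b) (h : ¬ D.Forced a b) : ∃ D' : DAG V, D.MarkovEquiv D' ∧ D'.Adj b a := by
  let A : Set V := {y | Relation.ReflTransGen D.Adj y b}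
  have hA : ∀ {x y}, D.Adj x y → y ∈ A → x ∈ A := fun hxy hy => Relation.ReflTransGen.head hxy hy
  have hempty : ∀ y ∈ A, D.colliderParents y = ∅ := fun y hy =>
    Finset.eq_empty_of_forall_notMem fun p hp =>
      not_forced_of_reflTransGen hab h hy p (.collider hp)
  have hparent : ∀ y ∈ A, ∀ x x', D.Adj x y → D.Adj x' y → x = x' := by
    intro y hy x x' hx hx'
    by_contra hne
    have := mem_colliderParents_of_adj hx hx' hne
    rw [hempty y hy] at this
    exact Finset.notMem_empty _ this
  let q : V → V → Prop := fun y x => y ∈ A ∧ D.Adj x y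
  have hq : Relator.RightUnique q := fun y x x' hx hx' => hparent y hx.1 x x' hx.2 hx'.2
  have hqA : ∀ y ∈ A, Relation.ReflTransGen q b y := by
    intro y hy
    refine Relation.ReflTransGen.head_induction_on (motive := fun y _ => Relation.ReflTransGen q b y)
      hy .refl fun hxy hyb ih => ih.tail ⟨hyb, hxy⟩
  have hqD : ∀ {x y}, Relation.ReflTransGen q x y → Relation.ReflTransGen D.Adj y x := by
    intro x y hxy
    induction hxy with
    | refl => exact .refl
    | tail _ hyz ih => exact .head hyz.2 ih
  have hchild' : ∀ {y x x'}, D.Adj y x → D.Adj y x' → x' ∈ A →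
      Relation.ReflTransGen D.Adj x x' → x = x' := by
    intro y x x' hx hx' hA' hxx'
    rcases Relation.ReflTransGen.cases_tail hxx' with h | ⟨z, hxz, hzx'⟩
    · exact h.symm
    · rw [hparent x' hA' z y hzx' hx'] at hxz
      exact (D.acyclic y (Relation.TransGen.head' hx hxz)).elim
  -- Vertices of `A` have at most one parent, so `A` is a single directed path ending in `b`. A
  -- vertex therefore has at most one child in `A`, and the reversal creates no collider there.
  have hchild : ∀ {y x x'}, D.Adj y x → D.Adj y x' → x ∈ A → x' ∈ A → x = x' := by
    intro y x x' hx hx' hxA hxA'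
    rcases Relation.ReflTransGen.total_of_right_unique hq (hqA x hxA) (hqA x' hxA') with h | h
    · exact (hchild' hx' hx hxA (hqD h)).symm
    · exact hchild' hx hx' hxA' (hqD h)
  let r : V → V → Prop := fun x y => (D.Adj x y ∧ y ∉ A) ∨ (D.Adj y x ∧ x ∈ A)
  have hr : ∀ x y, r x y → G.Adj x y := by
    rintro x y (⟨h, -⟩ | ⟨h, -⟩)
    · exact graph_adj hD h
    · exact (graph_adj hD h).symm
  have hasymm : ∀ x y, r x y → ¬ r y x := by
    rintro x y (⟨h, hy⟩ | ⟨h, hx⟩) (⟨h', hy'⟩ | ⟨h', hx'⟩)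
    · exact not_adj_symm h h'
    · exact hy hx'
    · exact hy' hx
    · exact not_adj_symm h h'
  have htotal : ∀ x y, G.Adj x y → r x y ∨ r y x := by
    intro x y hxy
    rcases adj_or hD hxy with h | h
    · by_cases hy : y ∈ A
      · exact Or.inr (Or.inr ⟨h, hy⟩)
      · exact Or.inl (Or.inl ⟨h, hy⟩)
    · by_cases hx : x ∈ A
      · exact Or.inl (Or.inr ⟨h, hx⟩)
      · exact Or.inr (Or.inl ⟨h, hx⟩)
  have hskel := ofOrientation_skeleton hG r hr hasymm htotal
  refine ⟨ofOrientation hG r hr hasymm, (markovEquiv_iff hG hD hskel).2 ?_,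
    Or.inr ⟨hab, .refl⟩⟩
  funext y
  by_cases hy : y ∈ A
  · rw [hempty y hy, eq_comm]
    refine Finset.eq_empty_of_forall_notMem fun x hx => ?_
    obtain ⟨hx, x', hne, hx'⟩ := mem_colliderParents.1 hx
    have hx : D.Adj y x ∧ x ∈ A := hx.resolve_left fun h => h.2 hy
    have hx' : D.Adj y x' ∧ x' ∈ A := hx'.resolve_left fun h => h.2 hy
    exact hne (hchild hx'.1 hx.1 hx'.2 hx.2)
  · have : ∀ x, r x y ↔ D.Adj x y := fun x =>
      ⟨fun h => (h.resolve_right fun h => hy (hA h.1 h.2)).1, fun h => Or.inl ⟨h, hy⟩⟩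
    ext x
    simp only [mem_colliderParents]
    exact (and_congr (this x) (exists_congr fun k => and_congr_right fun _ => this k)).symm

theorem forced_of_arrow (hG : G.IsAcyclic) (hD : D.skeleton = G) {a b : V}
    (h : D.essentialGraph.Arrow a b) : D.Forced a b := by
  by_contra hn
  obtain ⟨D', hD', hba⟩ :=
    exists_markovEquiv_adj_of_not_forced hG hD (h D ⟨rfl, fun _ _ _ => Iff.rfl⟩) hn
  exact not_adj_symm hba (h D' hD')

theorem Forced.adj {a b : V} (h : D.Forced a b) : D.Adj a b := by
  cases h with
  | collider h => exact adj_of_mem_colliderParents h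
  | step _ h => exact h

/-- `F` has at each vertex the v-structures of `D` or those of `E`. -/
def IsBetween (D E F : DAG V) : Prop :=
  ∀ i, F.colliderParents i = D.colliderParents i ∨ F.colliderParents i = E.colliderParents i

theorem IsBetween.swap (h : IsBetween D E F) : IsBetween E D F := fun i => (h i).symm

/-- If `F` had `b → a`, then `b` and `p` would collide at `a` in `F`, hence also in `D`. -/
theorem adj_of_adj_of_colliderParents_eq (hF : F.skeleton = G) (hD : D.skeleton = G) {p a b : V}
    (h : F.colliderParents a = D.colliderParents a) (hpa : D.Adj p a) (hab : D.Adj a b)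
    (hFpa : F.Adj p a) : F.Adj a b := by
  refine (adj_or hF (graph_adj hD hab)).resolve_right fun hba => not_adj_symm hab ?_
  have hne : b ≠ p := by
    rintro rfl
    exact not_adj_symm hab hpa
  exact adj_of_mem_colliderParents (h ▸ mem_colliderParents_of_adj hba hFpa hne)

theorem adj_of_colliderParents_nonempty (hF : F.skeleton = G) (hD : D.skeleton = G) {a b : V}
    (h : F.colliderParents a = D.colliderParents a) (hne : (D.colliderParents a).Nonempty)
    (hab : D.Adj a b) : F.Adj a b := by
  refine (adj_or hF (graph_adj hD hab)).resolve_right fun hba => not_adj_symm hab ?_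
  exact adj_of_mem_colliderParents (h ▸ mem_colliderParents_of_nonempty (h ▸ hne) hba)

/-- All arrows of `D` in the span of `Δ` are reversed in `E`. -/
def Opposite (G : SimpleGraph V) (D E : DAG V) : Prop :=
  ∀ a ∈ treeSpan G (deltaSet G D E), ∀ b ∈ treeSpan G (deltaSet G D E), D.Adj a b → E.Adj b a

/-- Induction along the forcing chain. The last clause, locating `i` at `b` or upstream of `a`, is
needed only to keep the induction going. -/
theorem forced_cases (hG : G.IsAcyclic) (hD : D.skeleton = G) (hE : E.skeleton = G)
    (hop : Opposite G D E) {a b : V} (h : D.Forced a b) :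
    (∀ F : DAG V, F.skeleton = G → IsBetween D E F → F.Adj a b) ∨
      ∃ i ∈ deltaSet G D E, (∀ F : DAG V, F.skeleton = G → IsBetween D E F →
          F.colliderParents i = D.colliderParents i → F.Adj a b) ∧
        (i = b ∧ (D.colliderParents b).Nonempty ∨ Relation.ReflTransGen D.Adj i a) := by
  have hnd : ∀ {i}, i ∉ deltaSet G D E → ∀ F : DAG V, IsBetween D E F →
      F.colliderParents i = D.colliderParents i := fun {i} hi F hF => by
    have := not_ne_iff.1 (fun hne => hi ((mem_deltaSet_iff hG hD hE).2 hne))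
    exact (hF i).elim id fun h => h.trans this.symm
  induction h with
  | @collider a b hab =>
    by_cases hb : b ∈ deltaSet G D E
    · exact Or.inr ⟨b, hb, fun F _ _ h => adj_of_mem_colliderParents (h ▸ hab),
        Or.inl ⟨rfl, a, hab⟩⟩
    · exact Or.inl fun F _ hF => adj_of_mem_colliderParents (hnd hb F hF ▸ hab)
  | @step p a b hpa hab ih =>
    have hpa := hpa.adj
    by_cases ha : a ∈ deltaSet G D E
    · by_cases hne : (D.colliderParents a).Nonempty
      · exact Or.inr ⟨a, ha, fun F hF _ h => adj_of_colliderParents_nonempty hF hD h hne hab,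
          Or.inr .refl⟩
      · rcases ih with ih | ⟨i, hi, ih, ⟨-, h⟩ | hip⟩
        · exact Or.inr ⟨a, ha, fun F hF hFb h =>
            adj_of_adj_of_colliderParents_eq hF hD h hpa hab (ih F hF hFb), Or.inr .refl⟩
        · exact (hne h).elim
        -- As `i` is upstream of `p`, the arrow `p → a` separates two vertices of `Δ`, so it lies in
        -- the span and `E` reverses it. Were `F` like `E` at `a`, it would have `a → p`, against
        -- the control by `i`.
        · refine Or.inr ⟨i, hi, fun F hF hFb h => ?_, Or.inr (hip.tail hpa)⟩
          have hFpa := ih F hF hFb h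
          have hpT : p ∈ treeSpan G (deltaSet G D E) :=
            mem_treeSpan_of_edgeSide hi ha (mem_edgeSide_of_reflTransGen hD hip hpa)
              (hG.right_notMem_edgeSide (graph_adj hD hpa))
          have hEap := hop p hpT a (subset_treeSpan _ ha) hpa
          rcases hFb a with h | h
          · exact adj_of_adj_of_colliderParents_eq hF hD h hpa hab hFpa
          · have hneE : (E.colliderParents a).Nonempty := by
              rw [Finset.nonempty_iff_ne_empty]
              intro h0
              exact (mem_deltaSet_iff hG hD hE).1 ha
                ((Finset.not_nonempty_iff_eq_empty.1 hne).trans h0.symm)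
            exact (not_adj_symm (adj_of_colliderParents_nonempty hF hE h hneE hEap) hFpa).elim
    · rcases ih with ih | ⟨i, hi, ih, ⟨rfl, -⟩ | hip⟩
      · exact Or.inl fun F hF hFb =>
          adj_of_adj_of_colliderParents_eq hF hD (hnd ha F hFb) hpa hab (ih F hF hFb)
      · exact (ha hi).elim
      · exact Or.inr ⟨i, hi, fun F hF hFb h => adj_of_adj_of_colliderParents_eq hF hD
          (hnd ha F hFb) hpa hab (ih F hF hFb h), Or.inr (hip.tail hpa)⟩

/-- The direction of a forced arrow in the span of `Δ` is controlled by one vertex of `Δ`. -/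
theorem Forced.exists_control (hG : G.IsAcyclic) (hD : D.skeleton = G) (hE : E.skeleton = G)
    (hop : Opposite G D E) {a b : V} (h : D.Forced a b) (ha : a ∈ treeSpan G (deltaSet G D E))
    (hb : b ∈ treeSpan G (deltaSet G D E)) :
    ∃ i ∈ deltaSet G D E, ∀ F : DAG V, F.skeleton = G → IsBetween D E F →
      F.colliderParents i = D.colliderParents i → F.Adj a b := by
  rcases forced_cases hG hD hE hop h with h' | ⟨i, hi, h', -⟩
  -- `E` itself is between `D` and `E` and reverses the arrow.
  · exact (not_adj_symm (h' E hE fun _ => Or.inr rfl) (hop a ha b hb h.adj)).elim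
  · exact ⟨i, hi, h'⟩

end DAG

/-! ### Tight DAGs between the two ends of a flip -/

namespace DAG

variable {V : Type*} {G : SimpleGraph V} {D E F : DAG V}

theorem adj_of_isEssentialFlip (h : IsEssentialFlip G D E) {a b : V}
    (ha : a ∈ treeSpan G (deltaSet G D E)) (hb : b ∈ treeSpan G (deltaSet G D E))
    (hab : D.Adj a b) : D.essentialGraph.Arrow a b ∧ E.essentialGraph.Arrow b a := by
  have hrefl : ∀ F : DAG V, F.MarkovEquiv F := fun _ => ⟨rfl, fun _ _ _ => Iff.rfl⟩
  have hD' : D.essentialGraph.Arrow a b := by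
    by_contra hn
    exact (h.2.1 a ha b hb).1
      ⟨skeleton_adj.2 (Or.inl hab), hn, fun hba => not_adj_symm hab (hba D (hrefl D))⟩
  exact ⟨hD', (h.2.2 a ha b hb).1 hD'⟩

theorem opposite_of_isEssentialFlip (h : IsEssentialFlip G D E) :
    Opposite G D E := fun _ ha _ hb hab =>
  (adj_of_isEssentialFlip h ha hb hab).2 E ⟨rfl, fun _ _ _ => Iff.rfl⟩

theorem Opposite.swap (hD : D.skeleton = G) (hE : E.skeleton = G) (h : Opposite G D E) :
    Opposite G E D := by
  intro a ha b hb hab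
  rw [deltaSet_comm] at ha hb
  exact (adj_or hD (graph_adj hE hab)).resolve_left
    fun hab' => not_adj_symm hab (h a ha b hb hab')

/-- `F` agrees with `E` on the edge between `a` and `b`. -/
def AgreeAt (E F : DAG V) (a b : V) : Prop := F.Adj a b ↔ E.Adj a b

theorem agreeAt_comm (hE : E.skeleton = G) (hF : F.skeleton = G) {a b : V} (hab : G.Adj a b) :
    AgreeAt E F a b ↔ AgreeAt E F b a := by
  have h1 := adj_or hE hab
  have h2 := adj_or hF hab
  have h3 := E.not_adj_symm (i := a) (j := b)
  have h4 := F.not_adj_symm (i := a) (j := b)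
  unfold AgreeAt
  tauto

theorem agreeAt_iff (hE : E.skeleton = G) (hF : F.skeleton = G) {a b : V} (hba : E.Adj b a) :
    AgreeAt E F a b ↔ F.Adj b a := by
  rw [agreeAt_comm hE hF (graph_adj hE hba).symm]
  exact iff_true_right hba

variable [Fintype V]

/-- Among the DAGs between `D` and `E`, looking like `E` at `j` implies looking like `E` at `i`. -/
def Implies (G : SimpleGraph V) (D E : DAG V) (j i : V) : Prop :=
  ∀ F : DAG V, F.skeleton = G → IsBetween D E F →
    F.colliderParents j = E.colliderParents j → F.colliderParents i = E.colliderParents i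

/-- All implications between vertices of `Δ` are equivalences at `F`. -/
def IsTight (G : SimpleGraph V) (D E F : DAG V) : Prop :=
  ∀ j ∈ deltaSet G D E, ∀ i ∈ deltaSet G D E, Implies G D E j i →
    (F.colliderParents j = E.colliderParents j ↔ F.colliderParents i = E.colliderParents i)

theorem exists_controls (hG : G.IsAcyclic) (hD : D.skeleton = G) (hE : E.skeleton = G)
    (h : IsEssentialFlip G D E) {a b : V} (ha : a ∈ treeSpan G (deltaSet G D E))
    (hb : b ∈ treeSpan G (deltaSet G D E)) (hab : D.Adj a b) :
    ∃ j ∈ deltaSet G D E, ∃ i ∈ deltaSet G D E, ∀ F : DAG V, F.skeleton = G → IsBetween D E F →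
      (F.colliderParents j = E.colliderParents j → F.Adj b a) ∧
      (F.Adj b a → F.colliderParents i = E.colliderParents i) := by
  have hop := opposite_of_isEssentialFlip h
  obtain ⟨hDab, hEba⟩ := adj_of_isEssentialFlip h ha hb hab
  obtain ⟨i, hi, hi'⟩ := (forced_of_arrow hG hD hDab).exists_control hG hD hE hop ha hb
  obtain ⟨j, hj, hj'⟩ := (forced_of_arrow hG hE hEba).exists_control hG hE hD (hop.swap hD hE)
    (deltaSet_comm (G := G) ▸ hb) (deltaSet_comm (G := G) ▸ ha)
  refine ⟨j, deltaSet_comm (G := G) ▸ hj, i, hi, fun F hF hb => ⟨hj' F hF hb.swap, fun hba => ?_⟩⟩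
  exact (hb i).resolve_left fun h => not_adj_symm hba (hi' F hF hb h)

/-- One of `D`, `E` has a collider at `x`. If `E` does, looking like `E` at `x` gives `b → a`, hence
looking like `E` at `i`; otherwise looking like `E` at `j` gives `b → a`, hence looking like `E` at
`x`. Tightness reverses the chain. -/
theorem IsTight.iff_adj (hG : G.IsAcyclic) (hD : D.skeleton = G) (hE : E.skeleton = G)
    (h : IsEssentialFlip G D E) (hF : F.skeleton = G) (hFb : IsBetween D E F)
    (hFt : IsTight G D E F) {a b x : V} (ha : a ∈ treeSpan G (deltaSet G D E))
    (hb : b ∈ treeSpan G (deltaSet G D E)) (hab : D.Adj a b) (hx : x ∈ deltaSet G D E)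
    (hxab : x = a ∨ x = b) :
    F.colliderParents x = E.colliderParents x ↔ F.Adj b a := by
  obtain ⟨j, hj, i, hi, hc⟩ := exists_controls hG hD hE h ha hb hab
  have hEba := opposite_of_isEssentialFlip h a ha b hb hab
  by_cases hne : (E.colliderParents x).Nonempty
  · have key : ∀ F : DAG V, F.skeleton = G → F.colliderParents x = E.colliderParents x →
        F.Adj b a := by
      intro F hF hx
      rcases hxab with rfl | rfl
      · exact adj_of_mem_colliderParents (hx ▸ mem_colliderParents_of_nonempty hne hEba)
      · exact adj_of_colliderParents_nonempty hF hE hx hne hEba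
    have := hFt x hx i hi fun F hF hFb hx => (hc F hF hFb).2 (key F hF hx)
    exact ⟨key F hF, fun hba => this.2 ((hc F hF hFb).2 hba)⟩
  · have hneD : (D.colliderParents x).Nonempty := by
      rw [Finset.nonempty_iff_ne_empty]
      intro h0
      exact (mem_deltaSet_iff hG hD hE).1 hx
        (h0.trans (Finset.not_nonempty_iff_eq_empty.1 hne).symm)
    have key : ∀ F : DAG V, F.skeleton = G → IsBetween D E F → F.Adj b a →
        F.colliderParents x = E.colliderParents x := by
      intro F hF hFb hba
      refine (hFb x).resolve_left fun hx => not_adj_symm hba ?_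
      rcases hxab with rfl | rfl
      · exact adj_of_colliderParents_nonempty hF hD hx hneD hab
      · exact adj_of_mem_colliderParents (hx ▸ mem_colliderParents_of_nonempty hneD hab)
    have := hFt j hj x hx fun F hF hFb hj => key F hF hFb ((hc F hF hFb).1 hj)
    exact ⟨fun hx => (hc F hF hFb).1 (this.2 hx), key F hF hFb⟩

theorem IsTight.iff_agreeAt (hG : G.IsAcyclic) (hD : D.skeleton = G) (hE : E.skeleton = G)
    (h : IsEssentialFlip G D E) (hF : F.skeleton = G) (hFb : IsBetween D E F)
    (hFt : IsTight G D E F) {a x : V} (ha : a ∈ treeSpan G (deltaSet G D E))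
    (hx : x ∈ deltaSet G D E) (hax : G.Adj a x) :
    F.colliderParents x = E.colliderParents x ↔ AgreeAt E F a x := by
  have hop := opposite_of_isEssentialFlip h
  have hxT := subset_treeSpan (G := G) _ hx
  rcases adj_or hD hax with hD' | hD'
  · rw [agreeAt_iff hE hF (hop a ha x hxT hD')]
    exact hFt.iff_adj hG hD hE h hF hFb ha hxT hD' hx (Or.inr rfl)
  · rw [agreeAt_comm hE hF hax, agreeAt_iff hE hF (hop x hxT a ha hD')]
    exact hFt.iff_adj hG hD hE h hF hFb hxT ha hD' hx (Or.inl rfl)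

/-- Without a change at `u`, reversing `u → w` reverses `t → u`, since otherwise `t → u` would force
`u → w`. So a control of the second edge implies a control of the first, and tightness closes the
loop. -/
theorem IsTight.adj_iff_adj_of_path (hG : G.IsAcyclic) (hD : D.skeleton = G) (hE : E.skeleton = G)
    (h : IsEssentialFlip G D E) (hF : F.skeleton = G) (hFb : IsBetween D E F)
    (hFt : IsTight G D E F) {t u w : V} (ht : t ∈ treeSpan G (deltaSet G D E))
    (hu : u ∈ treeSpan G (deltaSet G D E)) (hw : w ∈ treeSpan G (deltaSet G D E))
    (huΔ : u ∉ deltaSet G D E) (htu : D.Adj t u) (huw : D.Adj u w) :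
    F.Adj u t ↔ F.Adj w u := by
  have heq : ∀ F : DAG V, IsBetween D E F → F.colliderParents u = D.colliderParents u := by
    intro F hF
    have := not_ne_iff.1 fun hne => huΔ ((mem_deltaSet_iff hG hD hE).2 hne)
    exact (hF u).elim id fun h => h.trans this.symm
  have key : ∀ F : DAG V, F.skeleton = G → IsBetween D E F → F.Adj w u → F.Adj u t := by
    intro F hF hFb hwu
    refine (adj_or hF (graph_adj hD htu)).resolve_left fun htu' => not_adj_symm hwu ?_
    exact adj_of_adj_of_colliderParents_eq hF hD (heq F hFb) htu huw htu'
  obtain ⟨_, _, i, hi, hc⟩ := exists_controls hG hD hE h ht hu htu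
  obtain ⟨j, hj, _, _, hc'⟩ := exists_controls hG hD hE h hu hw huw
  have := hFt j hj i hi fun F hF hFb hj =>
    (hc F hF hFb).2 (key F hF hFb ((hc' F hF hFb).1 hj))
  exact ⟨fun hut => (hc' F hF hFb).1 (this.2 ((hc F hF hFb).2 hut)), key F hF hFb⟩

theorem IsTight.agreeAt_iff_agreeAt (hG : G.IsAcyclic) (hD : D.skeleton = G) (hE : E.skeleton = G)
    (h : IsEssentialFlip G D E) (hF : F.skeleton = G) (hFb : IsBetween D E F)
    (hFt : IsTight G D E F) {t u w : V} (ht : t ∈ treeSpan G (deltaSet G D E))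
    (hu : u ∈ treeSpan G (deltaSet G D E)) (hw : w ∈ treeSpan G (deltaSet G D E))
    (htu : G.Adj t u) (huw : G.Adj u w) :
    AgreeAt E F t u ↔ AgreeAt E F u w := by
  by_cases huΔ : u ∈ deltaSet G D E
  · rw [← hFt.iff_agreeAt hG hD hE h hF hFb ht huΔ htu, agreeAt_comm hE hF huw,
      ← hFt.iff_agreeAt hG hD hE h hF hFb hw huΔ huw.symm]
  by_cases htw : t = w
  · subst htw
    exact agreeAt_comm hE hF htu
  have hop := opposite_of_isEssentialFlip h
  have heq := not_ne_iff.1 fun hne => huΔ ((mem_deltaSet_iff hG hD hE).2 hne)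
  rcases adj_or hD htu with h1 | h1 <;> rcases adj_or hD huw with h2 | h2
  · rw [agreeAt_iff hE hF (hop t ht u hu h1), agreeAt_iff hE hF (hop u hu w hw h2)]
    exact hFt.adj_iff_adj_of_path hG hD hE h hF hFb ht hu hw huΔ h1 h2
  -- A collider of `D` at `u ∉ Δ` persists in `E`, although `E` reverses both arrows; the next case
  -- is the same with `D` and `E` exchanged.
  · have := adj_of_mem_colliderParents (heq ▸ mem_colliderParents_of_adj h1 h2 htw)
    exact (not_adj_symm this (hop t ht u hu h1)).elim
  · have := adj_of_mem_colliderParents (heq.symm ▸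
      mem_colliderParents_of_adj (hop u hu t ht h1) (hop u hu w hw h2) htw)
    exact (not_adj_symm this h1).elim
  · rw [agreeAt_comm hE hF htu, agreeAt_comm hE hF huw,
      agreeAt_iff hE hF (hop u hu t ht h1), agreeAt_iff hE hF (hop w hw u hu h2)]
    exact (hFt.adj_iff_adj_of_path hG hD hE h hF hFb hw hu ht huΔ h2 h1).symm

theorem IsTight.agreeAt_iff_of_walk (hG : G.IsAcyclic) (hD : D.skeleton = G) (hE : E.skeleton = G)
    (h : IsEssentialFlip G D E) (hF : F.skeleton = G) (hFb : IsBetween D E F)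
    (hFt : IsTight G D E F) {u v : V} (p : G.Walk u v)
    (hp : ∀ z ∈ p.support, z ∈ treeSpan G (deltaSet G D E)) (hv : v ∈ deltaSet G D E) {t : V}
    (ht : t ∈ treeSpan G (deltaSet G D E)) (htu : G.Adj t u) :
    AgreeAt E F t u ↔ F.colliderParents v = E.colliderParents v := by
  induction p generalizing t with
  | nil => exact (hFt.iff_agreeAt hG hD hE h hF hFb ht hv htu).symm
  | @cons u w v huw p ih =>
    have hu := hp u (SimpleGraph.Walk.start_mem_support _)
    have hp' : ∀ z ∈ p.support, z ∈ treeSpan G (deltaSet G D E) := fun z hz =>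
      hp z (List.mem_cons_of_mem _ hz)
    rw [hFt.agreeAt_iff_agreeAt hG hD hE h hF hFb ht hu
      (hp' w (SimpleGraph.Walk.start_mem_support _)) htu huw]
    exact ih hp' hv hu huw

theorem IsTight.iff_of_mem_deltaSet (hG : G.IsTree) (hD : D.skeleton = G) (hE : E.skeleton = G)
    (h : IsEssentialFlip G D E) (hF : F.skeleton = G) (hFb : IsBetween D E F)
    (hFt : IsTight G D E F) {x y : V} (hx : x ∈ deltaSet G D E) (hy : y ∈ deltaSet G D E) :
    F.colliderParents x = E.colliderParents x ↔ F.colliderParents y = E.colliderParents y := by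
  obtain ⟨p, hp⟩ := exists_walk_support_subset_treeSpan hG hx hy
  cases p with
  | nil => rfl
  | @cons _ w _ hxw p =>
    have hp' : ∀ z ∈ p.support, z ∈ treeSpan G (deltaSet G D E) := fun z hz =>
      hp z (List.mem_cons_of_mem _ hz)
    rw [hFt.iff_agreeAt hG.isAcyclic hD hE h hF hFb
        (hp' w (SimpleGraph.Walk.start_mem_support _)) hx hxw.symm,
      ← agreeAt_comm hE hF hxw]
    exact hFt.agreeAt_iff_of_walk hG.isAcyclic hD hE h hF hFb p hp' hy (subset_treeSpan _ hx) hxw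

theorem IsTight.imset_eq (hG : G.IsTree) (hD : D.skeleton = G) (hE : E.skeleton = G)
    (h : IsEssentialFlip G D E) (hF : F.skeleton = G) (hFb : IsBetween D E F)
    (hFt : IsTight G D E F) : F.imset = D.imset ∨ F.imset = E.imset := by
  have hac := hG.isAcyclic
  rw [imset_eq_iff_colliderParents hac hF hD, imset_eq_iff_colliderParents hac hF hE]
  have heq : ∀ i ∉ deltaSet G D E, D.colliderParents i = E.colliderParents i :=
    fun i hi => not_ne_iff.1 fun hne => hi ((mem_deltaSet_iff hac hD hE).2 hne)
  by_cases hx : ∃ x ∈ deltaSet G D E, F.colliderParents x = E.colliderParents x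
  · obtain ⟨x, hx, hx'⟩ := hx
    refine Or.inr (funext fun i => ?_)
    by_cases hi : i ∈ deltaSet G D E
    · exact (hFt.iff_of_mem_deltaSet hG hD hE h hF hFb hx hi).1 hx'
    · exact (hFb i).elim (fun h => h.trans (heq i hi)) id
  · push Not at hx
    refine Or.inl (funext fun i => ?_)
    by_cases hi : i ∈ deltaSet G D E
    · exact (hFb i).resolve_right (hx i hi)
    · exact (hFb i).elim id fun h => h.trans (heq i hi).symm

end DAG

/-! ### The supporting functional of a flip -/

namespace DAG

variable {V : Type*} {G : SimpleGraph V} {D E F : DAG V}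

/-- The functions on the DAGs with skeleton `G` that are affine in the characteristic imset. -/
def affineInImset (G : SimpleGraph V) : Submodule ℝ (DAG V → ℝ) where
  carrier := {f | ∃ (l : StrongDual ℝ (ImsetIndex V → ℝ)) (k : ℝ),
    ∀ F : DAG V, F.skeleton = G → f F = l F.imset + k}
  add_mem' := by
    rintro f g ⟨l, k, hf⟩ ⟨l', k', hg⟩
    refine ⟨l + l', k + k', fun F hF => ?_⟩
    rw [Pi.add_apply, hf F hF, hg F hF, _root_.add_apply]
    ring
  zero_mem' := ⟨0, 0, fun F _ => by simp⟩
  smul_mem' := by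
    rintro c f ⟨l, k, hf⟩
    refine ⟨c • l, c * k, fun F hF => ?_⟩
    rw [Pi.smul_apply, hf F hF, _root_.smul_apply, smul_eq_mul, smul_eq_mul]
    ring

theorem mem_affineInImset_of_eqOn {f g : DAG V → ℝ} (hg : g ∈ affineInImset G)
    (h : ∀ F : DAG V, F.skeleton = G → f F = g F) : f ∈ affineInImset G := by
  obtain ⟨l, k, hg⟩ := hg
  exact ⟨l, k, fun F hF => (h F hF).trans (hg F hF)⟩

theorem const_mem_affineInImset (c : ℝ) : (fun _ => c) ∈ affineInImset G :=
  ⟨0, c, fun F _ => by simp⟩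

theorem imset_mem_affineInImset (S : ImsetIndex V) : (fun F => F.imset S) ∈ affineInImset G :=
  ⟨ContinuousLinearMap.proj S, 0, fun F _ => by simp⟩

variable [Fintype V]

open Classical in
/-- The indicator function of the DAGs with prescribed collider parents at `i`. -/
noncomputable def localIndicator (i : V) (B : Finset V) (F : DAG V) : ℝ :=
  if F.colliderParents i = B then 1 else 0

theorem localIndicator_of_eq {i : V} {B : Finset V} (h : F.colliderParents i = B) :
    localIndicator i B F = 1 := if_pos h

theorem localIndicator_of_ne {i : V} {B : Finset V} (h : F.colliderParents i ≠ B) :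
    localIndicator i B F = 0 := if_neg h

open Classical in
theorem sum_localIndicator (i : V) (s : Finset (Finset V)) :
    ∑ B ∈ s, localIndicator i B F = if F.colliderParents i ∈ s then 1 else 0 := by
  simp only [localIndicator, Finset.sum_ite_eq]

open Classical in
/-- Möbius inversion: the local indicators are affine in the characteristic imset. -/
theorem localIndicator_mem_affineInImset (hG : G.IsAcyclic) (i : V) (B : Finset V) :
    localIndicator i B ∈ affineInImset G := by
  -- Descending induction: the indicator of `B` is that of containing `B`, minus the indicators of
  -- all proper supersets. Containment of `B` is an imset entry, or the constant 1 for `B = ∅`; any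
  -- other `B` never occurs as a set of collider parents.
  induction B using WellFoundedGT.induction with
  | _ B ih =>
  have hsum : (∑ B' ∈ Finset.univ.filter (B ⊂ ·), localIndicator i B') ∈ affineInImset G :=
    Submodule.sum_mem _ fun B' hB' => ih B' (Finset.mem_filter.1 hB').2
  by_cases hB0 : B = ∅
  · subst hB0
    refine mem_affineInImset_of_eqOn (Submodule.sub_mem _ (const_mem_affineInImset 1) hsum) ?_
    intro F _
    rw [Pi.sub_apply, Finset.sum_apply, sum_localIndicator]
    simp only [Finset.mem_filter, Finset.mem_univ, true_and, Finset.empty_ssubset,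
      Finset.nonempty_iff_ne_empty, localIndicator]
    split_ifs <;> simp_all
  by_cases hB : (∀ j ∈ B, G.Adj i j) ∧ 2 ≤ B.card
  · have hiB : i ∉ B := fun h => (hB.1 i h).ne rfl
    have hcard : (insert i B).card = B.card + 1 := Finset.card_insert_of_notMem hiB
    let S : ImsetIndex V := ⟨insert i B, by omega⟩
    have hS : S ∈ localSets G i := by
      refine ⟨Finset.mem_insert_self _ _, fun j hj => ?_, ?_⟩
      · exact (Finset.mem_insert.1 hj).imp id (hB.1 j)
      · change 3 ≤ (insert i B).card
        omega
    refine mem_affineInImset_of_eqOn (Submodule.sub_mem _ (imset_mem_affineInImset S) hsum) ?_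
    intro F hF
    have hFS : F.imset S = 1 ↔ B ⊆ F.colliderParents i := by
      rw [imset_eq_one_iff_of_mem_localSets hG hF hS]
      refine ⟨fun h j hj => h j (Finset.mem_insert_of_mem hj) ?_, fun h j hj hji => ?_⟩
      · rintro rfl
        exact hiB hj
      · exact h ((Finset.mem_insert.1 hj).resolve_left hji)
    rw [Pi.sub_apply, Finset.sum_apply, sum_localIndicator]
    simp only [Finset.mem_filter, Finset.mem_univ, true_and]
    by_cases h1 : F.colliderParents i = B
    · rw [localIndicator_of_eq h1, hFS.2 h1.ge, if_neg, sub_zero]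
      rw [h1]
      exact fun h => h.ne rfl
    · rw [localIndicator_of_ne h1]
      by_cases h2 : B ⊆ F.colliderParents i
      · rw [hFS.2 h2, if_pos (h2.ssubset_of_ne (Ne.symm h1)), sub_self]
      · rw [(F.imset_eq_zero_or_one S).resolve_right (mt hFS.1 h2), if_neg (fun h => h2 h.subset),
          sub_self]
  · refine mem_affineInImset_of_eqOn (Submodule.zero_mem _) fun F hF => ?_
    refine localIndicator_of_ne ?_
    rintro rfl
    refine hB ⟨fun j hj => (graph_adj hF (adj_of_mem_colliderParents hj)).symm, ?_⟩
    obtain ⟨j, hj⟩ := Finset.nonempty_iff_ne_empty.2 hB0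
    obtain ⟨k, hk, hkj⟩ := exists_ne_mem_colliderParents hj
    exact Finset.one_lt_card.2 ⟨j, hj, k, hk, hkj.symm⟩

/-- The deviation of `F` at `i` from both `D` and `E`. -/
noncomputable def localDefect (G : SimpleGraph V) (D E : DAG V) (i : V) (F : DAG V) : ℝ :=
  open Classical in
  -- Off `Δ` the two patterns coincide and must be counted once.
  if i ∈ deltaSet G D E then
    localIndicator i (D.colliderParents i) F + localIndicator i (E.colliderParents i) F - 1
  else localIndicator i (D.colliderParents i) F - 1

theorem localDefect_mem_affineInImset (hG : G.IsAcyclic) (i : V) :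
    localDefect G D E i ∈ affineInImset G := by
  have hD := localIndicator_mem_affineInImset hG i (D.colliderParents i)
  have hE := localIndicator_mem_affineInImset hG i (E.colliderParents i)
  by_cases hi : i ∈ deltaSet G D E
  · refine mem_affineInImset_of_eqOn
      (Submodule.sub_mem _ (Submodule.add_mem _ hD hE) (const_mem_affineInImset 1)) fun F _ => ?_
    simp [localDefect, hi]
  · refine mem_affineInImset_of_eqOn
      (Submodule.sub_mem _ hD (const_mem_affineInImset 1)) fun F _ => ?_
    simp [localDefect, hi]

theorem localDefect_eq (hG : G.IsAcyclic) (hD : D.skeleton = G) (hE : E.skeleton = G) (i : V) :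
    localDefect G D E i F = 0 ∧ (F.colliderParents i = D.colliderParents i ∨
      F.colliderParents i = E.colliderParents i) ∨
    localDefect G D E i F = -1 ∧ ¬ (F.colliderParents i = D.colliderParents i ∨
      F.colliderParents i = E.colliderParents i) := by
  have hΔ := mem_deltaSet_iff hG hD hE (i := i)
  unfold localDefect localIndicator
  by_cases hi : i ∈ deltaSet G D E
  · have := hΔ.1 hi
    by_cases h1 : F.colliderParents i = D.colliderParents i
    · simp [hi, h1, this]
    · by_cases h2 : F.colliderParents i = E.colliderParents i
      · simp [hi, h2, this.symm]
      · simp [hi, h1, h2]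
  · have := not_ne_iff.1 fun hne => hi (hΔ.2 hne)
    by_cases h1 : F.colliderParents i = D.colliderParents i
    · simp [hi, h1]
    · simp [hi, h1, ← this]

/-- The contribution of a pair of vertices of `Δ` related by an implication. -/
noncomputable def implicationTerm (G : SimpleGraph V) (D E : DAG V) (q : V × V) (F : DAG V) : ℝ :=
  open Classical in
  if q.1 ∈ deltaSet G D E ∧ q.2 ∈ deltaSet G D E ∧ Implies G D E q.1 q.2 then
    localIndicator q.1 (E.colliderParents q.1) F - localIndicator q.2 (E.colliderParents q.2) F
  else 0

theorem implicationTerm_mem_affineInImset (hG : G.IsAcyclic) (q : V × V) :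
    implicationTerm G D E q ∈ affineInImset G := by
  have h1 := localIndicator_mem_affineInImset hG q.1 (E.colliderParents q.1)
  have h2 := localIndicator_mem_affineInImset hG q.2 (E.colliderParents q.2)
  by_cases hq : q.1 ∈ deltaSet G D E ∧ q.2 ∈ deltaSet G D E ∧ Implies G D E q.1 q.2
  · exact mem_affineInImset_of_eqOn (Submodule.sub_mem _ h1 h2) fun F _ => if_pos hq
  · exact mem_affineInImset_of_eqOn (Submodule.zero_mem _) fun F _ => if_neg hq

theorem implicationTerm_le_one (q : V × V) : implicationTerm G D E q F ≤ 1 := by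
  unfold implicationTerm localIndicator
  split_ifs <;> norm_num

theorem implicationTerm_nonpos (hF : F.skeleton = G) (hFb : IsBetween D E F) (q : V × V) :
    implicationTerm G D E q F ≤ 0 := by
  unfold implicationTerm localIndicator
  split_ifs with h h1 h2
  · norm_num
  · exact (h2 (h.2.2 F hF hFb h1)).elim
  · norm_num
  · norm_num
  · exact le_rfl

theorem isTight_of_implicationTerm_eq_zero (hF : F.skeleton = G) (hFb : IsBetween D E F)
    (h : ∀ q, implicationTerm G D E q F = 0) : IsTight G D E F := by
  intro j hj i hi hji
  refine ⟨hji F hF hFb, fun hi' => ?_⟩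
  by_contra hj'
  have := h (j, i)
  rw [implicationTerm, if_pos ⟨hj, hi, hji⟩, localIndicator_of_eq hi', localIndicator_of_ne hj']
    at this
  norm_num at this

theorem implicationTerm_left (hG : G.IsAcyclic) (hD : D.skeleton = G) (hE : E.skeleton = G)
    (q : V × V) : implicationTerm G D E q D = 0 := by
  unfold implicationTerm
  split_ifs with h
  · rw [localIndicator_of_ne ((mem_deltaSet_iff hG hD hE).1 h.1),
      localIndicator_of_ne ((mem_deltaSet_iff hG hD hE).1 h.2.1), sub_self]
  · rfl

theorem implicationTerm_right (q : V × V) : implicationTerm G D E q E = 0 := by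
  unfold implicationTerm
  split_ifs
  · rw [localIndicator_of_eq rfl, localIndicator_of_eq rfl, sub_self]
  · rfl

/-- A function affine in the characteristic imset that is maximal exactly at the imsets of `D`
and `E`. -/
theorem exists_affine_of_isEssentialFlip (hG : G.IsTree) (hD : D.skeleton = G)
    (hE : E.skeleton = G) (h : IsEssentialFlip G D E) : ∃ f ∈ affineInImset G,
      f D = 0 ∧ f E = 0 ∧ ∀ F : DAG V, F.skeleton = G →
        f F ≤ 0 ∧ (f F = 0 → F.imset = D.imset ∨ F.imset = E.imset) := by
  classical
  have hac := hG.isAcyclic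
  -- Each implication term is at most 1, so one defect of `-1` times `M` outweighs all of them
  -- together.
  let M : ℝ := Fintype.card (V × V) + 1
  have hM : 0 < M := by positivity
  let f : DAG V → ℝ := M • ∑ i, localDefect G D E i + ∑ q, implicationTerm G D E q
  have hf : ∀ F, f F = M * ∑ i, localDefect G D E i F + ∑ q, implicationTerm G D E q F := by
    intro F
    simp [f, Finset.sum_apply]
  have hdef : ∀ F, IsBetween D E F → ∀ i, localDefect G D E i F = 0 := fun F hF i => by
    rcases localDefect_eq hac hD hE i (F := F) with h | h
    · exact h.1
    · exact (h.2 (hF i)).elim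
  have hfb : ∀ F, IsBetween D E F → f F = ∑ q, implicationTerm G D E q F := by
    intro F hF
    rw [hf, Finset.sum_eq_zero fun i _ => hdef F hF i, mul_zero, zero_add]
  refine ⟨f, Submodule.add_mem _ (Submodule.smul_mem _ _ (Submodule.sum_mem _ fun i _ =>
    localDefect_mem_affineInImset hac i)) (Submodule.sum_mem _ fun q _ =>
    implicationTerm_mem_affineInImset hac q), ?_, ?_, fun F hF => ?_⟩
  · rw [hfb D fun _ => Or.inl rfl]
    exact Finset.sum_eq_zero fun q _ => implicationTerm_left hac hD hE q
  · rw [hfb E fun _ => Or.inr rfl]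
    exact Finset.sum_eq_zero fun q _ => implicationTerm_right q
  by_cases hFb : IsBetween D E F
  · rw [hfb F hFb]
    have hnp : ∀ q ∈ Finset.univ, implicationTerm G D E q F ≤ 0 :=
      fun q _ => implicationTerm_nonpos hF hFb q
    refine ⟨Finset.sum_nonpos hnp, fun h0 => ?_⟩
    refine (isTight_of_implicationTerm_eq_zero hF hFb fun q => ?_).imset_eq hG hD hE h hF hFb
    exact (Finset.sum_eq_zero_iff_of_nonpos hnp).1 h0 q (Finset.mem_univ q)
  · have hlt : f F < 0 := by
      obtain ⟨i, hi⟩ := not_forall.1 hFb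
      have hle : ∀ i, localDefect G D E i F ≤ 0 := fun i => by
        rcases localDefect_eq hac hD hE i (F := F) with h | h <;> linarith [h.1]
      have h1 : ∑ i, localDefect G D E i F ≤ -1 := by
        rw [← Finset.add_sum_erase _ _ (Finset.mem_univ i)]
        have hi' : localDefect G D E i F = -1 := by
          rcases localDefect_eq hac hD hE i (F := F) with h | h
          · exact (hi h.2).elim
          · exact h.1
        linarith [Finset.sum_nonpos fun j (_ : j ∈ Finset.univ.erase i) => hle j]
      have h2 : ∑ q, implicationTerm G D E q F ≤ Fintype.card (V × V) := by
        refine (Finset.sum_le_sum fun q _ => implicationTerm_le_one q).trans ?_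
        simp
      rw [hf]
      have := mul_le_mul_of_nonneg_left h1 hM.le
      simp only [M] at this ⊢
      linarith
    exact ⟨hlt.le, fun h0 => (hlt.ne h0).elim⟩

theorem isPolytopeEdge_of_isEssentialFlip (hG : G.IsTree) (hD : D.skeleton = G)
    (hE : E.skeleton = G) (h : IsEssentialFlip G D E) :
    IsPolytopeEdge (CIM G) (convexHull ℝ {D.imset, E.imset}) := by
  obtain ⟨f, ⟨l, k, hf⟩, hfD, hfE, hle⟩ := exists_affine_of_isEssentialFlip hG hD hE h
  constructor
  · refine isExposed_convexHull_pair (finite_imset_image _) ⟨D, hD, rfl⟩ ⟨E, hE, rfl⟩ l (-k)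
      ?_ ?_ ?_ ?_
    · linarith [hf D hD]
    · linarith [hf E hE]
    · rintro _ ⟨F, hF, rfl⟩
      linarith [hf F hF, (hle F hF).1]
    · rintro _ ⟨F, hF, rfl⟩ hF'
      exact (hle F hF).2 (by linarith [hf F hF])
  · refine finrank_vectorSpan_convexHull_pair.2 fun heq => h.1 ?_
    exact (markovEquiv_iff hG.isAcyclic hD hE).2
      ((imset_eq_iff_colliderParents hG.isAcyclic hD hE).1 heq)

end DAG

theorem mainTheorem1 {V : Type*} [Fintype V] (G : SimpleGraph V) (hG : G.IsTree)
    (D E : DAG V) (hD : D.skeleton = G) (hE : E.skeleton = G) :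
    IsPolytopeEdge (CIM G) (convexHull ℝ {D.imset, E.imset}) ↔ IsEssentialFlip G D E :=
  ⟨DAG.isEssentialFlip_of_isPolytopeEdge hG hD hE, DAG.isPolytopeEdge_of_isEssentialFlip hG hD hE⟩
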